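/- For $\alpha,\beta>0$ let $W_{\alpha,\beta}(z)=\sum_{k\ge0}\frac{z^k}{k!\,\Gamma(\alpha k+\beta)}$ be the Wright function, let $I_0(z)=\sum_{k\ge0}\frac{(z/2)^{2k}}{(k!)^2}$ be the modified Bessel function of the first kind of order zero, and let $$\Phi_{a,b}(t,t')=\frac1\pi\int_0^{\infty}\frac{\sin\left(t'u^a\sin(\pi a)+\pi b\right)}{u^{b}\exp\left(ut+t'u^a\cos(\pi a)\right)}\,du+\delta_{b,1}\qquad(0<a<1,\ b\le 1),$$ where $\delta_{b,1}$ is the Kronecker symbol. Let $\lambda\in\mathbb R$; if $\lambda t_1<0$, then $\sqrt{\lambda t_1}$ is the principal complex square root (the choice is irrelevant since $I_0$ is even). (i) Let $0<\alpha<1$ and $0<\beta\le 1+\alpha$. For every $t>0$, and also for $t=0$ when $\beta>1$ and $\alpha<\tfrac12$, the integral defining $\Phi_{\alpha,\beta-\alpha}(t,t_1)$ converges absolutely for every $t_1>0$, the function $t_1\mapsto \Phi_{\alpha,\beta-\alpha}(t,t_1)\,I_0(2\sqrt{\lambda t_1})$ is integrable on $(0,\infty)$, and $$t^{\beta-1}W_{\alpha,\beta}(\lambda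 t^{\alpha})=\int_0^{\infty}\Phi_{\alpha,\beta-\alpha}(t,t_1)\,I_0\left(2\sqrt{\lambda t_1}\right)dt_1 .$$ (ii) The same formula holds for every $t\ge0$ in the two degenerate cases $\alpha=1$, $\beta=2$, where $\Phi_{1,1}(t,t_1)=\Theta(t-t_1)$ is the Heaviside function (and the integrand is integrable), and $\alpha=1$, $\beta=1$, where $\Phi_{1,0}(t,t_1)=\delta(t-t_1)$ is the delta function, understood as the unit point mass at $t_1=t$ on $[0,\infty)$. -/

import Mathlib

open MeasureTheory Set

noncomputable section

/-- The Wright function `W_{α,β}(z) = ∑_{k ≥ 0} z^k / (k! Γ(α k + β))`. -/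
def wright (α β : ℝ) (z : ℂ) : ℂ :=
  ∑' k : ℕ, z ^ k / ((k.factorial : ℂ) * (Real.Gamma (α * k + β) : ℂ))

/-- The modified Bessel function of the first kind of order zero,
`I_0(z) = ∑_{k ≥ 0} (z/2)^{2k} / (k!)^2`. -/
def besselI0 (z : ℂ) : ℂ :=
  ∑' k : ℕ, (z / 2) ^ (2 * k) / (k.factorial : ℂ) ^ 2

/-- The function of `u` under the integral sign in the Efros-type kernel. -/
def efrosIntegrand (a b t t' u : ℝ) : ℝ :=
  Real.sin (t' * u ^ a * Real.sin (Real.pi * a) + Real.pi * b) /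
    (u ^ b * Real.exp (u * t + t' * u ^ a * Real.cos (Real.pi * a)))

/-- The Efros-type kernel `Φ_{a,b}(t,t')`; the last summand is the Kronecker symbol `δ_{b,1}`. -/
def efrosKernel (a b t t' : ℝ) : ℝ :=
  Real.pi⁻¹ * (∫ u in Ioi (0 : ℝ), efrosIntegrand a b t t' u) + (if b = 1 then 1 else 0)

/-- The Heaviside function, with value `1` at the origin. -/
def heavisideStep (x : ℝ) : ℝ := if 0 ≤ x then 1 else 0

/-- `I_0(2 √(lam * t'))`, where the square root is the principal complex one, so that
`lam * t'` may be negative. -/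
def besselFactor (lam t' : ℝ) : ℂ :=
  besselI0 (2 * ((lam * t' : ℝ) : ℂ) ^ (1 / 2 : ℂ))

end

/-! The kernel is an inverse Laplace transform: Φ_{a,b}(t,τ) = (1/2πi) ∫ e^{tp} p^{-b} e^{-τ p^a} dp
over a Hankel contour. Its dependence on τ is a mixture of exponentials e^{-τP}, P = p^a. Since
I_0(2√(λτ)) = ∑ (λτ)^k / (k!)² and ∫ τ^k e^{-τP} dτ = k!/P^{k+1}, integrating over τ with a = α, b =
β - α gives ∑ λ^k/k! · (1/2πi) ∫ e^{tp} p^{-(αk+β)} dp. Hankel's formula for 1/Γ turns this into ∑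
λ^k t^{αk+β-1} / (k! Γ(αk+β)), the Wright side.

Two points need care. The integral defining Φ lives on the cut arg p = π, where Re p^a may be
negative and the interchange fails; the contour is therefore rotated to an angle θ with π/2 < θ and
aθ < π/2, so that e^{tp} decays and Re p^a stays bounded below (`efrosKernel_eq_logContour`,
`hasSum_integral_mixture_besselSeries`). Branch cuts are avoided by p = e^w, which makes the
integrand entire; by conjugation symmetry the upper half of the contour and an imaginary part
suffice. Hankel's formula itself (`im_logContour_hankelExp_eq`) comes from the kernel at τ = 0 and
integration by parts. -/

/-- The entire function `x ↦ ∑ x ^ k / (k!) ^ 2`, for which `I_0(2 √x)` is another name. -/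
noncomputable def besselSeries (x : ℝ) : ℝ := ∑' k : ℕ, x ^ k / (k.factorial : ℝ) ^ 2

theorem summable_besselSeries (x : ℝ) :
    Summable fun k : ℕ => x ^ k / (k.factorial : ℝ) ^ 2 := by
  refine Summable.of_norm_bounded (Real.summable_pow_div_factorial |x|) fun k => ?_
  have h1 : (1 : ℝ) ≤ k.factorial := by exact_mod_cast Nat.one_le_iff_ne_zero.2 k.factorial_ne_zero
  rw [norm_div, norm_pow, norm_pow, Real.norm_eq_abs, Real.norm_eq_abs, Nat.abs_cast]
  gcongr
  nlinarith

theorem besselFactor_eq (lam x : ℝ) : besselFactor lam x = (besselSeries (lam * x) : ℂ) := by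
  unfold besselFactor besselI0 besselSeries
  rw [Complex.ofReal_tsum]
  congr 1
  ext k
  rw [mul_div_cancel_left₀ _ (two_ne_zero), pow_mul]
  have : (((lam * x : ℝ) : ℂ) ^ (1 / 2 : ℂ)) ^ 2 = ((lam * x : ℝ) : ℂ) := by
    rw [one_div]; exact Complex.cpow_ofNat_inv_pow _ _
  rw [this]
  push_cast
  rfl

theorem continuous_besselSeries : Continuous besselSeries := by
  rw [continuous_iff_continuousAt]
  intro x
  have h : ContinuousOn besselSeries (Metric.ball 0 (|x| + 1)) := by
    refine continuousOn_tsum (fun k => by fun_prop) (summable_besselSeries (|x| + 1))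
      fun k y hy => ?_
    rw [mem_ball_zero_iff] at hy
    rw [norm_div, norm_pow, norm_pow, Real.norm_natCast]
    gcongr
  refine h.continuousAt (Metric.isOpen_ball.mem_nhds ?_)
  rw [mem_ball_zero_iff, Real.norm_eq_abs]
  linarith

/-- One of the two factors 1/k! absorbs (|lam|/d)^k, leaving the series of exp (d * x). As d is
arbitrary, the growth is beaten by any decaying exponential. -/
theorem besselSeries_le_exp {d : ℝ} (hd : 0 < d) (lam : ℝ) {x : ℝ} (hx : 0 ≤ x) :
    besselSeries (|lam| * x) ≤ Real.exp (|lam| / d) * Real.exp (d * x) := by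
  have h1 := (NormedSpace.expSeries_div_hasSum_exp (d * x)).mul_left (Real.exp (|lam| / d))
  rw [← Real.exp_eq_exp_ℝ] at h1
  rw [← h1.tsum_eq]
  refine Summable.tsum_le_tsum (fun k => ?_) (summable_besselSeries _) h1.summable
  have h2 : (|lam| / d) ^ k / k.factorial ≤ Real.exp (|lam| / d) :=
    Real.pow_div_factorial_le_exp _ (by positivity) k
  have h3 : (|lam| * x) ^ k / (k.factorial : ℝ) ^ 2 =
      (|lam| / d) ^ k / k.factorial * ((d * x) ^ k / k.factorial) := by
    have : |lam| * x = |lam| / d * (d * x) := by field_simp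
    rw [this, mul_pow]
    field_simp
  rw [h3]
  gcongr

theorem abs_besselSeries_le (y : ℝ) : |besselSeries y| ≤ besselSeries |y| := by
  have h : ∀ k : ℕ, ‖y ^ k / (k.factorial : ℝ) ^ 2‖ = |y| ^ k / (k.factorial : ℝ) ^ 2 := by
    intro k
    rw [norm_div, norm_pow, norm_pow, Real.norm_natCast, Real.norm_eq_abs]
  have := norm_tsum_le_tsum_norm (f := fun k : ℕ => y ^ k / (k.factorial : ℝ) ^ 2)
    (by simpa only [h] using summable_besselSeries |y|)
  simp only [h] at this
  exact this

/-! ### The degenerate cases α = 1 -/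

theorem hasSum_integral_besselSeries (lam : ℝ) {t : ℝ} (ht : 0 ≤ t) :
    HasSum (fun k : ℕ => lam ^ k * t ^ (k + 1) / (k.factorial * (k + 1).factorial : ℝ))
      (∫ x in (0 : ℝ)..t, besselSeries (lam * x)) := by
  have h := intervalIntegral.hasSum_integral_of_dominated_convergence
    (F := fun (k : ℕ) (x : ℝ) => (lam * x) ^ k / (k.factorial : ℝ) ^ 2)
    (f := fun x => besselSeries (lam * x)) (μ := volume) (a := 0) (b := t)
    (fun k _ => (|lam| * t) ^ k / (k.factorial : ℝ) ^ 2)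
    (fun k => by fun_prop)
    (fun k => by
      refine Filter.Eventually.of_forall fun x hx => ?_
      rw [uIoc_of_le ht] at hx
      rw [norm_div, norm_pow, norm_pow, Real.norm_natCast, norm_mul, Real.norm_eq_abs,
        Real.norm_eq_abs, abs_of_pos hx.1]
      have := hx.1
      have := hx.2
      gcongr)
    (Filter.Eventually.of_forall fun x _ => summable_besselSeries _)
    (by simp)
    (Filter.Eventually.of_forall fun x _ => (summable_besselSeries _).hasSum)
  refine (congrArg (HasSum · _) (funext fun k => ?_)).mpr h
  simp only [mul_pow]
  rw [intervalIntegral.integral_div, intervalIntegral.integral_const_mul, integral_pow]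
  have : ((k + 1).factorial : ℝ) = (k + 1) * k.factorial := by push_cast [Nat.factorial_succ]; ring
  rw [this]
  field_simp
  simp

theorem heaviside_formula (lam : ℝ) {t : ℝ} (ht : 0 ≤ t) :
    IntegrableOn (fun t₁ : ℝ => (heavisideStep (t - t₁) : ℂ) * besselFactor lam t₁) (Ioi 0) ∧
      ((t ^ ((2 : ℝ) - 1) : ℝ) : ℂ) * wright 1 2 ((lam * t ^ (1 : ℝ) : ℝ) : ℂ) =
        ∫ t₁ in Ioi (0 : ℝ), (heavisideStep (t - t₁) : ℂ) * besselFactor lam t₁ := by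
  have h1 : (fun t₁ : ℝ => (heavisideStep (t - t₁) : ℂ) * besselFactor lam t₁) =
      (Iic t).indicator fun x => ((besselSeries (lam * x) : ℝ) : ℂ) := by
    ext x
    rw [besselFactor_eq, indicator_apply, heavisideStep]
    by_cases hx : x ≤ t <;> simp [hx]
  have h2 : Continuous fun x => ((besselSeries (lam * x) : ℝ) : ℂ) := by
    have := continuous_besselSeries
    fun_prop
  rw [h1]
  constructor
  · rw [IntegrableOn, integrable_indicator_iff measurableSet_Iic, IntegrableOn,
      Measure.restrict_restrict measurableSet_Iic, inter_comm, Ioi_inter_Iic]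
    exact (h2.integrableOn_Icc (a := 0) (b := t)).mono_set Ioc_subset_Icc_self
  · rw [setIntegral_indicator measurableSet_Iic, Ioi_inter_Iic,
      ← intervalIntegral.integral_of_le ht, intervalIntegral.integral_ofReal,
      ← (hasSum_integral_besselSeries lam ht).tsum_eq, wright, Complex.ofReal_tsum, ← tsum_mul_left]
    congr 1
    ext k
    have h3 : Real.Gamma (1 * k + 2) = ((k + 1).factorial : ℝ) := by
      rw [← Real.Gamma_nat_eq_factorial]
      congr 1
      push_cast
      ring
    rw [h3]
    norm_num
    ring

theorem dirac_formula (lam : ℝ) {t : ℝ} (ht : 0 ≤ t) :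
    ((t ^ ((1 : ℝ) - 1) : ℝ) : ℂ) * wright 1 1 ((lam * t ^ (1 : ℝ) : ℝ) : ℂ) =
        ∫ t₁ in Ici (0 : ℝ), besselFactor lam t₁ ∂(Measure.dirac t) := by
  classical
  rw [setIntegral_dirac, if_pos (show t ∈ Ici (0 : ℝ) from ht), besselFactor_eq, wright, besselSeries, Complex.ofReal_tsum]
  simp only [sub_self, Real.rpow_zero, Complex.ofReal_one, one_mul, Real.rpow_one]
  congr 1
  ext k
  rw [Real.Gamma_nat_eq_factorial]
  push_cast
  ring

/-! ### Laplace transforms of the Bessel series -/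

open Filter Topology in
theorem integral_pow_mul_cexp_neg_mul_Ioi {P : ℂ} (hP : 0 < P.re) (k : ℕ) :
    IntegrableOn (fun x : ℝ => (x : ℂ) ^ k * Complex.exp (-(x * P))) (Ioi 0) ∧
      ∫ x in Ioi (0 : ℝ), (x : ℂ) ^ k * Complex.exp (-(x * P)) = k.factorial / P ^ (k + 1) := by
  have hP0 : P ≠ 0 := by rintro rfl; simp at hP
  have hnorm : ∀ (k : ℕ) (x : ℝ), 0 ≤ x →
      ‖(x : ℂ) ^ k * Complex.exp (-(x * P))‖ = x ^ k * Real.exp (-P.re * x) := by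
    intro k x hx
    rw [norm_mul, norm_pow, Complex.norm_real, Complex.norm_exp, Real.norm_of_nonneg hx]
    simp [mul_comm]
  have hint : ∀ k : ℕ,
      IntegrableOn (fun x : ℝ => (x : ℂ) ^ k * Complex.exp (-(x * P))) (Ioi 0) := by
    intro k
    have h := integrableOn_rpow_mul_exp_neg_mul_rpow (p := 1) (s := k) (b := P.re)
      (by linarith [(Nat.cast_nonneg k : (0 : ℝ) ≤ k)]) one_pos hP
    refine Integrable.mono' h (by fun_prop) ?_
    filter_upwards [ae_restrict_mem measurableSet_Ioi] with x hx
    rw [hnorm k x (le_of_lt hx), Real.rpow_natCast, Real.rpow_one]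
  refine ⟨hint k, ?_⟩
  induction k with
  | zero =>
    have h := integral_exp_mul_complex_Ioi (a := -P) (by simpa using hP) 0
    simp only [pow_zero, one_mul, zero_add, pow_one, Nat.factorial_zero, Nat.cast_one]
    simpa [mul_comm] using h
  | succ k ih =>
    have hd : ∀ x ∈ Ici (0 : ℝ), HasDerivAt (fun x : ℝ => (x : ℂ) ^ (k + 1) * Complex.exp (-(x * P)))
        ((k + 1) * ((x : ℂ) ^ k * Complex.exp (-(x * P))) -
          P * ((x : ℂ) ^ (k + 1) * Complex.exp (-(x * P)))) x := by
      intro x _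
      have h1 : HasDerivAt (fun x : ℝ => (x : ℂ)) 1 x := Complex.ofRealCLM.hasDerivAt
      have h2 := (h1.pow (k + 1)).mul ((h1.mul_const P).neg.cexp)
      refine h2.congr_deriv ?_
      push_cast
      simp
      ring
    have hi := ((hint k).const_mul ((k : ℂ) + 1)).sub ((hint (k + 1)).const_mul P)
    have hlim : Tendsto (fun x : ℝ => (x : ℂ) ^ (k + 1) * Complex.exp (-(x * P))) atTop (𝓝 0) := by
      rw [tendsto_zero_iff_norm_tendsto_zero]
      have h := tendsto_rpow_mul_exp_neg_mul_atTop_nhds_zero ((k + 1 : ℕ) : ℝ) P.re hP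
      refine h.congr' ?_
      filter_upwards [eventually_ge_atTop 0] with x hx
      rw [hnorm _ x hx, Real.rpow_natCast]
    have h := integral_Ioi_of_hasDerivAt_of_tendsto' hd hi hlim
    rw [integral_sub ((hint k).const_mul _) ((hint (k + 1)).const_mul P), integral_const_mul,
      integral_const_mul, ih] at h
    have h3 : P * ∫ x in Ioi (0 : ℝ), (x : ℂ) ^ (k + 1) * Complex.exp (-(x * P)) =
        (k + 1) * (k.factorial / P ^ (k + 1)) := by
      simp at h
      linear_combination -h
    rw [← mul_right_inj' hP0, h3, Nat.factorial_succ]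
    push_cast
    field_simp
    ring

/-- Integrating `besselSeries` against a mixture of decaying exponentials. -/
theorem hasSum_integral_mixture_besselSeries {X : Type*} [MeasurableSpace X] {ν : Measure X}
    [SFinite ν] {G P : X → ℂ} (hG : Integrable G ν) (hP : Measurable P) {ε : ℝ} (hε : 0 < ε)
    (hPε : ∀ᵐ x ∂ν, ε ≤ (P x).re) (lam : ℝ) :
    IntegrableOn (fun τ : ℝ => (∫ x, G x * Complex.exp (-(τ * P x)) ∂ν) * besselSeries (lam * τ))
      (Ioi 0) ∧
    HasSum (fun k : ℕ => (lam ^ k / k.factorial : ℂ) * ∫ x, G x * (P x ^ (k + 1))⁻¹ ∂ν)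
      (∫ τ in Ioi (0 : ℝ), (∫ x, G x * Complex.exp (-(τ * P x)) ∂ν) * besselSeries (lam * τ)) := by
  set m : Measure ℝ := volume.restrict (Ioi 0) with hm
  have hpos : ∀ᵐ z ∂(ν.prod m), ε ≤ (P z.1).re ∧ 0 < z.2 := by
    have h1 : ∀ᵐ z ∂(ν.prod m), ε ≤ (P z.1).re :=
      Measure.quasiMeasurePreserving_fst.ae hPε
    have h2 : ∀ᵐ z ∂(ν.prod m), z.2 ∈ Ioi (0 : ℝ) :=
      Measure.quasiMeasurePreserving_snd.ae (ae_restrict_mem measurableSet_Ioi)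
    filter_upwards [h1, h2] with z hz1 hz2 using ⟨hz1, hz2⟩
  have hexp : ∀ x : X, ∀ τ : ℝ, ε ≤ (P x).re → 0 < τ →
      ‖G x * Complex.exp (-(τ * P x))‖ ≤ ‖G x‖ * Real.exp (-(ε * τ)) := by
    intro x τ h1 h2
    rw [norm_mul, Complex.norm_exp]
    gcongr
    simp
    nlinarith
  have hmeas : AEStronglyMeasurable
      (fun z : X × ℝ => G z.1 * Complex.exp (-(z.2 * P z.1))) (ν.prod m) := by
    refine hG.aestronglyMeasurable.comp_fst.mul (Measurable.aestronglyMeasurable ?_)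
    fun_prop
  -- Half of the decay rate ε is spent on the growth of the Bessel series; the other half remains
  -- for integrability.
  have hbess : Integrable (fun τ => Real.exp (-(ε * τ)) * besselSeries (|lam| * τ)) m := by
    have h := (integrableOn_exp_mul_Ioi (a := -(ε / 2)) (by linarith) 0).const_mul
      (Real.exp (|lam| / (ε / 2)))
    refine Integrable.mono' h ?_ ?_
    · have := continuous_besselSeries
      exact Continuous.aestronglyMeasurable (by fun_prop)
    · filter_upwards [ae_restrict_mem measurableSet_Ioi] with τ hτ
      have hτ' : 0 < τ := hτ
      have h1 := besselSeries_le_exp (half_pos hε) lam hτ'.le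
      have h2 := abs_besselSeries_le (|lam| * τ)
      rw [abs_of_nonneg (by positivity : 0 ≤ |lam| * τ)] at h2
      rw [norm_mul, Real.norm_eq_abs, Real.norm_eq_abs, Real.abs_exp]
      calc Real.exp (-(ε * τ)) * |besselSeries (|lam| * τ)|
          ≤ Real.exp (-(ε * τ)) * (Real.exp (|lam| / (ε / 2)) * Real.exp (ε / 2 * τ)) := by
            gcongr; exact h2.trans h1
        _ = Real.exp (|lam| / (ε / 2)) * (Real.exp (-(ε * τ)) * Real.exp (ε / 2 * τ)) := by ring
        _ = _ := by rw [← Real.exp_add]; ring_nf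
  -- This one majorant serves Fubini, the summation under the integral, and the integrability of
  -- each term.
  have hdom : Integrable
      (fun z : X × ℝ => ‖G z.1‖ * (Real.exp (-(ε * z.2)) * besselSeries (|lam| * z.2)))
      (ν.prod m) := hG.norm.mul_prod hbess
  have hF : Integrable (fun z : X × ℝ =>
      G z.1 * Complex.exp (-(z.2 * P z.1)) * (besselSeries (lam * z.2) : ℂ)) (ν.prod m) := by
    refine hdom.mono' (hmeas.mul (Measurable.aestronglyMeasurable ?_)) ?_
    · have := continuous_besselSeries.measurable
      fun_prop
    · filter_upwards [hpos] with z hz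
      have h1 := abs_besselSeries_le (lam * z.2)
      rw [abs_mul, abs_of_pos hz.2] at h1
      rw [norm_mul, Complex.norm_real, Real.norm_eq_abs, ← mul_assoc]
      exact mul_le_mul (hexp _ _ hz.1 hz.2) h1 (abs_nonneg _) (by positivity)
  have hpull : ∀ τ : ℝ, ∫ x, G x * Complex.exp (-(τ * P x)) * (besselSeries (lam * τ) : ℂ) ∂ν =
      (∫ x, G x * Complex.exp (-(τ * P x)) ∂ν) * besselSeries (lam * τ) :=
    fun τ => integral_mul_const _ _
  have hint := hF.integral_prod_right
  simp only [hpull] at hint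
  refine ⟨hint, ?_⟩
  have hswap : ∫ z, G z.1 * Complex.exp (-(z.2 * P z.1)) * (besselSeries (lam * z.2) : ℂ)
      ∂(ν.prod m) = ∫ τ, (∫ x, G x * Complex.exp (-(τ * P x)) ∂ν) * besselSeries (lam * τ) ∂m := by
    rw [integral_prod_symm _ hF]
    simp only [hpull]
  rw [← hswap]
  have hterm : ∀ k : ℕ, ∀ᵐ z ∂(ν.prod m),
      ‖G z.1 * Complex.exp (-(z.2 * P z.1)) *
        (((lam * z.2) ^ k / (k.factorial : ℝ) ^ 2 : ℝ) : ℂ)‖ ≤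
      ‖G z.1‖ * Real.exp (-(ε * z.2)) * ((|lam| * z.2) ^ k / (k.factorial : ℝ) ^ 2) := by
    intro k
    filter_upwards [hpos] with z hz
    have h1 : ‖(((lam * z.2) ^ k / (k.factorial : ℝ) ^ 2 : ℝ) : ℂ)‖ =
        (|lam| * z.2) ^ k / (k.factorial : ℝ) ^ 2 := by
      rw [Complex.norm_real, norm_div, norm_pow, norm_pow, Real.norm_natCast, norm_mul,
        Real.norm_eq_abs, Real.norm_of_nonneg hz.2.le]
    have h2 := hz.2.le
    rw [norm_mul, h1]
    exact mul_le_mul_of_nonneg_right (hexp _ _ hz.1 hz.2) (by positivity)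
  have hm1 : ∀ k : ℕ, AEStronglyMeasurable (fun z : X × ℝ => G z.1 * Complex.exp (-(z.2 * P z.1)) *
        (((lam * z.2) ^ k / (k.factorial : ℝ) ^ 2 : ℝ) : ℂ)) (ν.prod m) := fun k =>
    hmeas.mul (Measurable.aestronglyMeasurable (by fun_prop))
  have hbsum : (fun z : X × ℝ => ∑' k : ℕ, ‖G z.1‖ * Real.exp (-(ε * z.2)) *
      ((|lam| * z.2) ^ k / (k.factorial : ℝ) ^ 2)) =
      fun z => ‖G z.1‖ * (Real.exp (-(ε * z.2)) * besselSeries (|lam| * z.2)) := by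
    ext z
    rw [tsum_mul_left, besselSeries, mul_assoc]
  have hsum := hasSum_integral_of_dominated_convergence
    (F := fun (k : ℕ) (z : X × ℝ) => G z.1 * Complex.exp (-(z.2 * P z.1)) *
        (((lam * z.2) ^ k / (k.factorial : ℝ) ^ 2 : ℝ) : ℂ))
    (f := fun z => G z.1 * Complex.exp (-(z.2 * P z.1)) * (besselSeries (lam * z.2) : ℂ))
    (fun k z => ‖G z.1‖ * Real.exp (-(ε * z.2)) * ((|lam| * z.2) ^ k / (k.factorial : ℝ) ^ 2))
    hm1 hterm (Filter.Eventually.of_forall fun z => (summable_besselSeries _).mul_left _)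
    (by rw [hbsum]; exact hdom)
    (Filter.Eventually.of_forall fun z =>
      (Complex.hasSum_ofReal.2 (summable_besselSeries (lam * z.2)).hasSum).mul_left _)
  refine (congrArg (HasSum · _) (funext fun k => ?_)).mpr hsum
  have hFk : Integrable (fun z : X × ℝ => G z.1 * Complex.exp (-(z.2 * P z.1)) *
        (((lam * z.2) ^ k / (k.factorial : ℝ) ^ 2 : ℝ) : ℂ)) (ν.prod m) := by
    refine hdom.mono' (hm1 k) ?_
    filter_upwards [hterm k, hpos] with z h1 h2
    refine h1.trans ?_
    have h3 := h2.2.le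
    rw [mul_assoc]
    gcongr
    exact (summable_besselSeries (|lam| * z.2)).le_tsum k fun j _ => by positivity
  rw [integral_prod _ hFk, ← integral_const_mul]
  refine integral_congr_ae ?_
  filter_upwards [hPε] with x hx
  have hk := (integral_pow_mul_cexp_neg_mul_Ioi (hε.trans_le hx) k).2
  have h4 : ∀ τ : ℝ, G x * Complex.exp (-(τ * P x)) *
      (((lam * τ) ^ k / (k.factorial : ℝ) ^ 2 : ℝ) : ℂ) =
      G x * (lam ^ k / (k.factorial : ℂ) ^ 2) * ((τ : ℂ) ^ k * Complex.exp (-(τ * P x))) := by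
    intro τ
    push_cast
    ring
  simp only [h4]
  rw [integral_const_mul, hk]
  have : (k.factorial : ℂ) ≠ 0 := by exact_mod_cast k.factorial_ne_zero
  field_simp

/-! ### Hankel contours in the coordinate w = log p -/

open Complex in
/-- The function `p ^ (μ - 1) * exp (t * p - τ * p ^ a) dp` in the logarithmic coordinate
`p = exp w`, in which it is entire. -/
noncomputable def hankelExp (t τ a μ : ℝ) (w : ℂ) : ℂ :=
  exp (t * exp w - τ * exp (a * w) + μ * w)

open Complex in
/-- The integral of `f` along the vertical segment from `0` to `θ * I` followed by the horizontal
half-line from `θ * I` to `+∞ + θ * I`: the upper half of a Hankel contour in logarithmic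
coordinates. -/
noncomputable def logContour (θ : ℝ) (f : ℂ → ℂ) : ℂ :=
  (∫ x in Ioi (0 : ℝ), f (x + θ * I)) + I * ∫ y in (0 : ℝ)..θ, f (y * I)

theorem differentiable_hankelExp (t τ a μ : ℝ) : Differentiable ℂ (hankelExp t τ a μ) := by
  unfold hankelExp
  fun_prop

theorem continuous_hankelExp (t τ a μ : ℝ) : Continuous (hankelExp t τ a μ) :=
  (differentiable_hankelExp t τ a μ).continuous

open Complex in
theorem hankelExp_add_mul_I (t τ a μ x y : ℝ) :
    hankelExp t τ a μ (x + y * I) =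
      exp ((t * Real.exp x * Real.cos y - τ * Real.exp (a * x) * Real.cos (a * y) + μ * x : ℝ) +
        (t * Real.exp x * Real.sin y - τ * Real.exp (a * x) * Real.sin (a * y) + μ * y : ℝ) * I) := by
  have h : (a : ℂ) * (x + y * I) = (a * x : ℝ) + (a * y : ℝ) * I := by push_cast; ring
  rw [hankelExp, h, exp_add_mul_I, exp_add_mul_I]
  congr 1
  push_cast
  ring

open Complex in
theorem norm_hankelExp (t τ a μ x y : ℝ) :
    ‖hankelExp t τ a μ (x + y * I)‖ =
      Real.exp (t * Real.exp x * Real.cos y - τ * Real.exp (a * x) * Real.cos (a * y) + μ * x) := by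
  rw [hankelExp_add_mul_I, norm_exp]
  congr 1
  simp [-ofReal_add, -ofReal_sub, -ofReal_mul]

open Filter Topology in
-- After factoring out e^x the bracket tends to -κ < 0, so the expression tends to -∞; compactness
-- handles the remaining bounded interval. The proof runs with slope μ + 1 to gain the extra -x.
theorem exists_exp_growth_bound {κ a : ℝ} (hκ : 0 < κ) (ha : a < 1) (M μ : ℝ) :
    ∃ C, ∀ x : ℝ, 0 ≤ x → -κ * Real.exp x + M * Real.exp (a * x) + μ * x ≤ C - x := by
  have hlim : Tendsto (fun x : ℝ => Real.exp x * (-κ + M * Real.exp (-((1 - a) * x)) +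
      (μ + 1) * (x ^ (1 : ℕ) * Real.exp (-x)))) atTop atBot := by
    refine Real.tendsto_exp_atTop.atTop_mul_neg (C := -κ + M * 0 + (μ + 1) * 0) (by linarith) ?_
    refine (tendsto_const_nhds.add (tendsto_const_nhds.mul ?_)).add (tendsto_const_nhds.mul
      (Real.tendsto_pow_mul_exp_neg_atTop_nhds_zero 1))
    exact Real.tendsto_exp_neg_atTop_nhds_zero.comp
      (tendsto_id.const_mul_atTop (by linarith : 0 < 1 - a))
  obtain ⟨X, hX⟩ := eventually_atTop.1 (hlim.eventually_le_atBot 0)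
  have hcont : ContinuousOn (fun x : ℝ => Real.exp x * (-κ + M * Real.exp (-((1 - a) * x)) +
      (μ + 1) * (x ^ (1 : ℕ) * Real.exp (-x)))) (Icc 0 X) := by fun_prop
  obtain ⟨B, hB⟩ := (isCompact_Icc.image_of_continuousOn hcont).bddAbove
  refine ⟨max B 0, fun x hx => ?_⟩
  have heq : Real.exp x * (-κ + M * Real.exp (-((1 - a) * x)) +
      (μ + 1) * (x ^ (1 : ℕ) * Real.exp (-x))) =
      -κ * Real.exp x + M * Real.exp (a * x) + (μ + 1) * x := by
    have h1 : Real.exp (a * x) = Real.exp x * Real.exp (-((1 - a) * x)) := by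
      rw [← Real.exp_add]; ring_nf
    have h2 : Real.exp x * Real.exp (-x) = 1 := by rw [← Real.exp_add]; simp
    rw [h1]
    linear_combination (μ + 1) * x * h2
  have : -κ * Real.exp x + M * Real.exp (a * x) + (μ + 1) * x ≤ max B 0 := by
    rw [← heq]
    rcases le_total x X with h | h
    · exact le_max_of_le_left (hB (mem_image_of_mem _ ⟨hx, h⟩))
    · exact le_max_of_le_right (hX x h)
  linarith

open Complex in
theorem exists_norm_hankelExp_le {t τ a θ : ℝ} (μ : ℝ) (ht : 0 < t) (hτ : 0 ≤ τ) (ha : a < 1)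
    (hθ : 0 ≤ θ) (hcos : Real.cos θ < 0) :
    ∃ C, ∀ x : ℝ, 0 ≤ x → ∀ y ∈ Icc θ Real.pi,
      ‖hankelExp t τ a μ (x + y * I)‖ ≤ C * Real.exp (-x) := by
  obtain ⟨C, hC⟩ := exists_exp_growth_bound (κ := -(t * Real.cos θ)) (a := a)
    (by nlinarith) ha τ μ
  refine ⟨Real.exp C, fun x hx y hy => ?_⟩
  rw [norm_hankelExp, ← Real.exp_add, Real.exp_le_exp]
  refine le_trans ?_ (hC x hx)
  have h1 : Real.cos y ≤ Real.cos θ := Real.cos_le_cos_of_nonneg_of_le_pi hθ hy.2 hy.1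
  have h2 := Real.neg_one_le_cos (a * y)
  have h3 : t * Real.exp x * Real.cos y ≤ t * Real.exp x * Real.cos θ := by gcongr
  have h4 : τ * Real.exp (a * x) * (-1) ≤ τ * Real.exp (a * x) * Real.cos (a * y) := by gcongr
  linarith

open Complex in
-- At t = 0 the decay must come from e^{-τ p^a}; a < 1/2 keeps Re p^a positive on the whole closed
-- upper half-plane.
theorem exists_norm_hankelExp_zero_le {τ a : ℝ} (μ : ℝ) (hτ : 0 < τ) (ha : 0 < a)
    (ha2 : a < 1 / 2) :
    ∃ C, ∀ x : ℝ, 0 ≤ x → ∀ y ∈ Icc 0 Real.pi,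
      ‖hankelExp 0 τ a μ (x + y * I)‖ ≤ C * Real.exp (-x) := by
  have hcos : 0 < Real.cos (a * Real.pi) :=
    Real.cos_pos_of_mem_Ioo ⟨by nlinarith [Real.pi_pos], by nlinarith [Real.pi_pos]⟩
  -- The bound is used at a * x instead of x, so that its leading exponential is e^{ax}; hence the
  -- slope (μ + 1) / a.
  obtain ⟨C, hC⟩ := exists_exp_growth_bound (κ := τ * Real.cos (a * Real.pi)) (a := 0)
    (by positivity) one_pos 0 ((μ + 1) / a)
  refine ⟨Real.exp C, fun x hx y hy => ?_⟩
  rw [norm_hankelExp, ← Real.exp_add, Real.exp_le_exp]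
  have h1 : Real.cos (a * Real.pi) ≤ Real.cos (a * y) :=
    Real.cos_le_cos_of_nonneg_of_le_pi (mul_nonneg ha.le hy.1) (by nlinarith [Real.pi_pos])
      (by nlinarith [hy.2])
  have h2 := hC (a * x) (by positivity)
  have h3 : (μ + 1) / a * (a * x) = (μ + 1) * x := by field_simp
  have h4 : τ * Real.exp (a * x) * Real.cos (a * Real.pi) ≤
    τ * Real.exp (a * x) * Real.cos (a * y) := by gcongr
  have h5 : 0 ≤ a * x := by positivity
  rw [h3] at h2
  linarith

open Complex in
theorem integrableOn_horizontal {f : ℂ → ℂ} (hf : Continuous f) {θ C : ℝ}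
    (h : ∀ x : ℝ, 0 ≤ x → ‖f (x + θ * I)‖ ≤ C * Real.exp (-x)) :
    IntegrableOn (fun x : ℝ => f (x + θ * I)) (Ioi 0) := by
  have h1 := (integrableOn_exp_mul_Ioi (a := -1) (by norm_num) 0).const_mul C
  refine Integrable.mono' h1 (by fun_prop) ?_
  filter_upwards [ae_restrict_mem measurableSet_Ioi] with x hx
  simpa using h x (le_of_lt hx)

open Complex Filter Topology in
-- Cauchy's theorem on rectangles of width N: the far vertical side vanishes as N → ∞, and the near
-- one is the difference of the two arcs.
theorem logContour_eq_of_decay {f : ℂ → ℂ} (hf : Differentiable ℂ f) {φ θ C : ℝ} (hφθ : φ ≤ θ)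
    (h : ∀ x : ℝ, 0 ≤ x → ∀ y ∈ Icc φ θ, ‖f (x + y * I)‖ ≤ C * Real.exp (-x)) :
    logContour θ f = logContour φ f := by
  have hc := hf.continuous
  have hrect : ∀ N : ℝ, (∫ x in (0 : ℝ)..N, f (x + φ * I)) - (∫ x in (0 : ℝ)..N, f (x + θ * I)) +
      I * (∫ y in φ..θ, f (N + y * I)) - I * (∫ y in φ..θ, f (y * I)) = 0 := by
    intro N
    have := integral_boundary_rect_eq_zero_of_differentiableOn f (φ * I) (N + θ * I)
      hf.differentiableOn
    simpa using this
  have l1 := intervalIntegral_tendsto_integral_Ioi 0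
    (integrableOn_horizontal hc fun x hx => h x hx φ ⟨le_rfl, hφθ⟩) tendsto_id
  have l2 := intervalIntegral_tendsto_integral_Ioi 0
    (integrableOn_horizontal hc fun x hx => h x hx θ ⟨hφθ, le_rfl⟩) tendsto_id
  have l3 : Tendsto (fun N : ℝ => ∫ y in φ..θ, f (N + y * I)) atTop (𝓝 0) := by
    refine squeeze_zero_norm' (a := fun N => C * Real.exp (-N) * |θ - φ|) ?_ ?_
    · filter_upwards [eventually_ge_atTop 0] with N hN
      refine intervalIntegral.norm_integral_le_of_norm_le_const fun y hy => ?_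
      rw [uIoc_of_le hφθ] at hy
      exact h N hN y (Ioc_subset_Icc_self hy)
    · have := (Real.tendsto_exp_neg_atTop_nhds_zero.const_mul C).mul_const |θ - φ|
      simpa using this
  have lim := ((l1.sub l2).add (l3.const_mul I)).sub_const (I * ∫ y in φ..θ, f (y * I))
  have h0 := tendsto_nhds_unique lim (tendsto_const_nhds.congr fun N => (hrect N).symm)
  have hadd : (∫ y in (0 : ℝ)..φ, f (y * I)) + (∫ y in φ..θ, f (y * I)) =
      ∫ y in (0 : ℝ)..θ, f (y * I) :=
    intervalIntegral.integral_add_adjacent_intervals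
      (Continuous.intervalIntegrable (by fun_prop) _ _)
      (Continuous.intervalIntegrable (by fun_prop) _ _)
  rw [logContour, logContour, ← hadd]
  linear_combination -h0

/-! ### The kernel as a contour integral -/

open Complex in
-- With u = e^x, the point p = e^{x+πi} = -u lies on the upper lip of the cut, and e^x is the
-- Jacobian.
theorem exp_mul_efrosIntegrand (a b t τ x : ℝ) :
    Real.exp x * efrosIntegrand a b t τ (Real.exp x) =
      (hankelExp t τ a (1 - b) (x + Real.pi * I)).im := by
  have hrpow : ∀ c : ℝ, Real.exp x ^ c = Real.exp (c * x) := fun c => by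
    rw [← Real.exp_mul, mul_comm]
  rw [hankelExp_add_mul_I, exp_im, efrosIntegrand, hrpow, hrpow]
  simp only [add_re, add_im, mul_re, mul_im, ofReal_re, ofReal_im, I_re, I_im, mul_zero, mul_one,
    add_zero, zero_add, sub_self]
  have hs : t * Real.exp x * Real.sin Real.pi - τ * Real.exp (a * x) * Real.sin (a * Real.pi) +
      (1 - b) * Real.pi =
      Real.pi - (τ * Real.exp (a * x) * Real.sin (Real.pi * a) + Real.pi * b) := by
    rw [Real.sin_pi, mul_comm a Real.pi]; ring
  rw [hs, Real.sin_pi_sub, Real.cos_pi, ← Real.exp_add, mul_div_assoc', div_eq_iff (Real.exp_ne_zero _),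
    mul_right_comm (Real.exp _) (Real.sin _), ← Real.exp_add]
  congr 2
  rw [mul_comm a Real.pi]
  ring

theorem integrableOn_Ioi_iff_comp_exp (g : ℝ → ℝ) :
    IntegrableOn g (Ioi 0) ↔ Integrable fun x => Real.exp x * g (Real.exp x) := by
  have h := integrableOn_image_iff_integrableOn_abs_deriv_smul MeasurableSet.univ
    (fun x _ => (Real.hasDerivAt_exp x).hasDerivWithinAt) Real.exp_injective.injOn g
  rw [image_univ, Real.range_exp, integrableOn_univ] at h
  simpa using h

theorem integral_Ioi_eq_comp_exp (g : ℝ → ℝ) :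
    ∫ u in Ioi 0, g u = ∫ x, Real.exp x * g (Real.exp x) := by
  have h := integral_image_eq_integral_abs_deriv_smul MeasurableSet.univ
    (fun x _ => (Real.hasDerivAt_exp x).hasDerivWithinAt) Real.exp_injective.injOn g
  rw [image_univ, Real.range_exp, Measure.restrict_univ] at h
  simpa using h

open Complex in
theorem norm_hankelExp_pi_le {t τ a μ : ℝ} (ht : 0 ≤ t) (hτ : 0 ≤ τ) (ha : 0 < a) {x : ℝ}
    (hx : x ≤ 0) : ‖hankelExp t τ a μ (x + Real.pi * I)‖ ≤ Real.exp τ * Real.exp (μ * x) := by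
  rw [norm_hankelExp, ← Real.exp_add, Real.exp_le_exp, Real.cos_pi]
  have h1 : Real.exp (a * x) ≤ 1 := Real.exp_le_one_iff.2 (mul_nonpos_of_nonneg_of_nonpos ha.le hx)
  have h2 := Real.neg_one_le_cos (a * Real.pi)
  have h3 : τ * Real.exp (a * x) * (-1) ≤ τ * Real.exp (a * x) * Real.cos (a * Real.pi) := by
    gcongr
  have h4 : τ * Real.exp (a * x) ≤ τ * 1 := by gcongr
  have h5 : 0 ≤ t * Real.exp x := by positivity
  linarith

open Complex in
theorem integrableOn_Iic_im_hankelExp {t τ a b : ℝ} (ht : 0 ≤ t) (hτ : 0 ≤ τ) (ha : 0 < a)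
    (hb : b ≤ 1) :
    IntegrableOn (fun x : ℝ => (hankelExp t τ a (1 - b) (x + Real.pi * I)).im) (Iic 0) := by
  have hc := continuous_hankelExp t τ a (1 - b)
  rcases hb.lt_or_eq with hb | rfl
  · have h := (integrableOn_exp_mul_Iic (a := 1 - b) (by linarith) 0).const_mul (Real.exp τ)
    refine Integrable.mono' h (by fun_prop) ?_
    filter_upwards [ae_restrict_mem measurableSet_Iic] with x hx
    exact (abs_im_le_norm _).trans (norm_hankelExp_pi_le ht hτ ha hx)
  -- For b = 1 the modulus no longer decays as x → -∞; the sine of the phase, of size at most τ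
  -- e^{ax}, does.
  · have h := (integrableOn_exp_mul_Iic ha 0).const_mul (Real.exp τ * τ)
    refine Integrable.mono' h (by fun_prop) ?_
    filter_upwards [ae_restrict_mem measurableSet_Iic] with x hx
    have h1 := norm_hankelExp_pi_le (μ := 1 - 1) ht hτ ha hx
    rw [hankelExp_add_mul_I, norm_exp] at h1
    rw [hankelExp_add_mul_I, exp_im]
    simp only [add_re, add_im, mul_re, mul_im, ofReal_re, ofReal_im, I_re, I_im, mul_zero, mul_one,
      add_zero, zero_add, sub_self, zero_mul, Real.exp_zero, Real.sin_pi, zero_sub] at h1 ⊢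
    rw [Real.norm_eq_abs, abs_mul, Real.abs_exp, mul_assoc (Real.exp τ)]
    refine mul_le_mul h1 ?_ (abs_nonneg _) (Real.exp_nonneg _)
    rw [Real.sin_neg, abs_neg]
    refine Real.abs_sin_le_abs.trans ?_
    rw [abs_mul, abs_mul, Real.abs_exp, abs_of_nonneg hτ]
    exact mul_le_of_le_one_right (by positivity) (Real.abs_sin_le_one _)

open Complex Filter Topology in
-- This is the small arc around p = 0. Its limit is the source of the Kronecker symbol in the
-- kernel.
theorem tendsto_integral_hankelExp_atBot {t τ a b : ℝ} (ht : 0 ≤ t) (hτ : 0 ≤ τ) (ha : 0 < a)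
    (hb : b ≤ 1) :
    Tendsto (fun N : ℝ => ∫ y in (0 : ℝ)..Real.pi, hankelExp t τ a (1 - b) (N + y * I)) atBot
      (𝓝 (∫ _ in (0 : ℝ)..Real.pi, if b = 1 then (1 : ℂ) else 0)) := by
  have hc := continuous_hankelExp t τ a (1 - b)
  have hbound : ∀ N : ℝ, N ≤ 0 → ∀ y : ℝ, ‖hankelExp t τ a (1 - b) (N + y * I)‖ ≤
      Real.exp (t + τ) * Real.exp ((1 - b) * N) := by
    intro N hN y
    rw [norm_hankelExp, ← Real.exp_add, Real.exp_le_exp]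
    have h1 : Real.exp (a * N) ≤ 1 :=
      Real.exp_le_one_iff.2 (mul_nonpos_of_nonneg_of_nonpos ha.le hN)
    have h0 : Real.exp N ≤ 1 := Real.exp_le_one_iff.2 hN
    have h2 := Real.neg_one_le_cos (a * y)
    have h3 : τ * Real.exp (a * N) * (-1) ≤ τ * Real.exp (a * N) * Real.cos (a * y) := by gcongr
    have h4 : τ * Real.exp (a * N) ≤ τ * 1 := by gcongr
    have h5 : t * Real.exp N * Real.cos y ≤ t * Real.exp N :=
      mul_le_of_le_one_right (by positivity) (Real.cos_le_one y)
    have h6 : t * Real.exp N ≤ t := mul_le_of_le_one_right ht h0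
    linarith
  refine intervalIntegral.tendsto_integral_filter_of_dominated_convergence
    (fun _ => Real.exp (t + τ)) (Eventually.of_forall fun N => by fun_prop) ?_ (by simp) ?_
  · filter_upwards [eventually_le_atBot 0] with N hN
    refine Eventually.of_forall fun y _ => (hbound N hN y).trans ?_
    refine mul_le_of_le_one_right (Real.exp_nonneg _) (Real.exp_le_one_iff.2 ?_)
    exact mul_nonpos_of_nonneg_of_nonpos (by linarith) hN
  · refine Eventually.of_forall fun y _ => ?_
    split_ifs with h1
    · have hexp : ∀ c : ℝ, 0 < c →
          Tendsto (fun N : ℝ => exp (c * (N + y * I))) atBot (𝓝 0) := by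
        intro c hc
        rw [tendsto_zero_iff_norm_tendsto_zero]
        simp only [norm_exp]
        refine Real.tendsto_exp_atBot.comp ?_
        simpa using tendsto_id.const_mul_atBot hc
      have h2 := ((hexp 1 one_pos).const_mul (t : ℂ)).sub ((hexp a ha).const_mul (τ : ℂ))
      have h3 := (continuous_exp.tendsto _).comp h2
      simpa [hankelExp, h1, Function.comp_def] using h3
    · have hμ : 0 < 1 - b := sub_pos.2 (lt_of_le_of_ne hb h1)
      refine squeeze_zero_norm' (a := fun N => Real.exp (t + τ) * Real.exp ((1 - b) * N)) ?_ ?_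
      · filter_upwards [eventually_le_atBot 0] with N hN using hbound N hN y
      · have := (Real.tendsto_exp_atBot.comp (tendsto_id.const_mul_atBot hμ)).const_mul
          (Real.exp (t + τ))
        simpa [Function.comp_def] using this

open Complex Filter Topology in
theorem integral_Iic_im_hankelExp {t τ a b : ℝ} (ht : 0 ≤ t) (hτ : 0 ≤ τ) (ha : 0 < a)
    (hb : b ≤ 1) :
    ∫ x in Iic (0 : ℝ), (hankelExp t τ a (1 - b) (x + Real.pi * I)).im =
      (I * ∫ y in (0 : ℝ)..Real.pi, hankelExp t τ a (1 - b) (y * I)).im -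
        Real.pi * (if b = 1 then 1 else 0) := by
  set f := hankelExp t τ a (1 - b) with hfdef
  have hc : Continuous f := continuous_hankelExp t τ a (1 - b)
  have hreal : ∀ x : ℝ, (f x).im = 0 := by
    intro x
    have := hankelExp_add_mul_I t τ a (1 - b) x 0
    rw [hfdef]
    simp only [ofReal_zero, zero_mul, add_zero, mul_zero, Real.sin_zero, sub_self] at this
    rw [this, exp_ofReal_im]
  have him : ∀ (g : ℝ → ℂ) (p q : ℝ), Continuous g →
      (∫ x in p..q, g x).im = ∫ x in p..q, (g x).im := fun g p q hg =>
    (imCLM.intervalIntegral_comp_comm (hg.intervalIntegrable p q)).symm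
  -- The side on the real axis drops out, the integrand being real there.
  have hrect : ∀ N : ℝ, ∫ x in N..0, (f (x + Real.pi * I)).im =
      (I * ∫ y in (0 : ℝ)..Real.pi, f (y * I)).im - (I * ∫ y in (0 : ℝ)..Real.pi, f (N + y * I)).im := by
    intro N
    have h := integral_boundary_rect_eq_zero_of_differentiableOn f N (Real.pi * I)
      (differentiable_hankelExp t τ a (1 - b)).differentiableOn
    have h' := congrArg Complex.im h
    simp only [sub_im, add_im, smul_eq_mul, ofReal_re, ofReal_im, mul_re, I_re, I_im, mul_zero,
      sub_zero, mul_one, zero_mul, add_zero, ofReal_zero, mul_im, zero_add, zero_im] at h' ⊢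
    rw [him (fun x => f x) _ _ (by fun_prop), him (fun x => f (x + Real.pi * I)) _ _ (by fun_prop)] at h'
    simp only [hreal, intervalIntegral.integral_zero] at h'
    linarith
  have l1 := intervalIntegral_tendsto_integral_Iic 0
    (integrableOn_Iic_im_hankelExp ht hτ ha hb) tendsto_id
  have l2 := (continuous_im.tendsto _).comp
    ((tendsto_integral_hankelExp_atBot ht hτ ha hb).const_mul I)
  have l3 := l2.const_sub (I * ∫ y in (0 : ℝ)..Real.pi, f (y * I)).im
  have h0 := tendsto_nhds_unique l1 (l3.congr fun N => (hrect N).symm)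
  rw [h0]
  congr 1
  split_ifs <;> simp

open Complex in
theorem integrable_im_hankelExp {t τ a b C : ℝ} (ht : 0 ≤ t) (hτ : 0 ≤ τ) (ha : 0 < a)
    (hb : b ≤ 1)
    (h : ∀ x : ℝ, 0 ≤ x → ‖hankelExp t τ a (1 - b) (x + Real.pi * I)‖ ≤ C * Real.exp (-x)) :
    Integrable fun x : ℝ => (hankelExp t τ a (1 - b) (x + Real.pi * I)).im := by
  rw [← integrableOn_univ, ← Iic_union_Ioi (a := (0 : ℝ))]
  exact (integrableOn_Iic_im_hankelExp ht hτ ha hb).union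
    (integrableOn_horizontal (continuous_hankelExp _ _ _ _) h).im

open Complex in
theorem integrableOn_efrosIntegrand {t τ a b C : ℝ} (ht : 0 ≤ t) (hτ : 0 ≤ τ) (ha : 0 < a)
    (hb : b ≤ 1)
    (h : ∀ x : ℝ, 0 ≤ x → ‖hankelExp t τ a (1 - b) (x + Real.pi * I)‖ ≤ C * Real.exp (-x)) :
    IntegrableOn (fun u => efrosIntegrand a b t τ u) (Ioi 0) := by
  rw [integrableOn_Ioi_iff_comp_exp]
  simp only [exp_mul_efrosIntegrand]
  exact integrable_im_hankelExp ht hτ ha hb h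

open Complex in
theorem efrosKernel_eq_logContour_pi {t τ a b C : ℝ} (ht : 0 ≤ t) (hτ : 0 ≤ τ) (ha : 0 < a)
    (hb : b ≤ 1)
    (h : ∀ x : ℝ, 0 ≤ x → ‖hankelExp t τ a (1 - b) (x + Real.pi * I)‖ ≤ C * Real.exp (-x)) :
    efrosKernel a b t τ =
      Real.pi⁻¹ * (logContour Real.pi (hankelExp t τ a (1 - b))).im := by
  have hi := integrable_im_hankelExp ht hτ ha hb h
  have hh := integrableOn_horizontal (continuous_hankelExp _ _ _ _) h
  have him : ∫ x in Ioi (0 : ℝ), (hankelExp t τ a (1 - b) (x + Real.pi * I)).im =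
      (∫ x in Ioi (0 : ℝ), hankelExp t τ a (1 - b) (x + Real.pi * I)).im :=
    imCLM.integral_comp_comm hh
  rw [efrosKernel, integral_Ioi_eq_comp_exp]
  simp only [exp_mul_efrosIntegrand]
  rw [← intervalIntegral.integral_Iic_add_Ioi hi.integrableOn hi.integrableOn,
    integral_Iic_im_hankelExp ht hτ ha hb, him, logContour, add_im]
  have := Real.pi_ne_zero
  field_simp
  ring

theorem efrosKernel_eq_logContour {t τ a b θ : ℝ} (ht : 0 < t) (hτ : 0 ≤ τ) (ha : 0 < a)
    (ha1 : a < 1) (hb : b ≤ 1) (hθ : Real.pi / 2 < θ) (hθ' : θ ≤ Real.pi) :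
    efrosKernel a b t τ = Real.pi⁻¹ * (logContour θ (hankelExp t τ a (1 - b))).im := by
  have hpi := Real.pi_pos
  obtain ⟨C, hC⟩ := exists_norm_hankelExp_le (θ := θ) (1 - b) ht hτ ha1 (by linarith)
    (Real.cos_neg_of_pi_div_two_lt_of_lt hθ (by linarith))
  rw [efrosKernel_eq_logContour_pi ht.le hτ ha hb fun x hx => hC x hx _ ⟨hθ', le_rfl⟩,
    logContour_eq_of_decay (differentiable_hankelExp _ _ _ _) hθ' hC]

open Complex in
-- The contour can be rotated all the way to θ = 0, where the integrand is real and the imaginary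
-- part is zero.
theorem efrosKernel_zero {τ a b : ℝ} (hτ : 0 < τ) (ha : 0 < a) (ha2 : a < 1 / 2) (hb : b ≤ 1) :
    efrosKernel a b 0 τ = 0 := by
  have hpi := Real.pi_pos
  obtain ⟨C, hC⟩ := exists_norm_hankelExp_zero_le (1 - b) hτ ha ha2
  rw [efrosKernel_eq_logContour_pi le_rfl hτ.le ha hb fun x hx => hC x hx _ ⟨hpi.le, le_rfl⟩,
    logContour_eq_of_decay (differentiable_hankelExp _ _ _ _) hpi.le hC, logContour]
  have hreal : ∀ x : ℝ, hankelExp 0 τ a (1 - b) (x + (0 : ℝ) * I) =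
      ((Real.exp (-τ * Real.exp (a * x) + (1 - b) * x) : ℝ) : ℂ) := by
    intro x
    rw [hankelExp_add_mul_I]
    simp
  simp only [hreal]
  rw [integral_complex_ofReal]
  simp

/-! ### Hankel's formula for 1/Γ -/

theorem hankelExp_tau_zero (t a a' μ : ℝ) : hankelExp t 0 a μ = hankelExp t 0 a' μ := by
  ext w
  simp [hankelExp]

/-- For s < 1 the integral is Γ(1 - s) t^{s-1} sin(πs), and the reflection formula finishes; for s =
1 only the Kronecker term is left. -/
theorem efrosKernel_tau_zero {t a s : ℝ} (ht : 0 < t) (hs : 0 < s) (hs1 : s ≤ 1) :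
    efrosKernel a s t 0 = t ^ (s - 1) / Real.Gamma s := by
  rcases hs1.lt_or_eq with h1 | rfl
  · have hsin : 0 < Real.sin (Real.pi * s) :=
      Real.sin_pos_of_pos_of_lt_pi (by positivity) (by nlinarith [Real.pi_pos])
    have hint : ∫ u in Ioi (0 : ℝ), efrosIntegrand a s t 0 u =
        ∫ u in Ioi (0 : ℝ), Real.sin (Real.pi * s) *
          (u ^ ((1 - s) - 1) * Real.exp (-(t * u))) := by
      refine setIntegral_congr_fun measurableSet_Ioi fun u hu => ?_
      have hu' : 0 < u := hu
      simp only [efrosIntegrand]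
      rw [show 1 - s - 1 = -s by ring, Real.rpow_neg hu'.le, Real.exp_neg]
      simp only [zero_mul, zero_add, add_zero]
      rw [mul_comm t u]
      field_simp
    have hG := Real.Gamma_mul_Gamma_one_sub s
    have hG0 : 0 < Real.Gamma s := Real.Gamma_pos_of_pos hs
    rw [efrosKernel, hint, integral_const_mul,
      Real.integral_rpow_mul_exp_neg_mul_Ioi (by linarith) ht, if_neg h1.ne, add_zero,
      one_div, Real.inv_rpow ht.le, ← Real.rpow_neg ht.le, neg_sub]
    have hpi := Real.pi_ne_zero
    rw [eq_div_iff hsin.ne'] at hG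
    rw [eq_div_iff hG0.ne']
    field_simp
    linear_combination hG
  · simp [efrosKernel, efrosIntegrand]

open Complex in
theorem integrableOn_horizontal_hankelExp {t τ a θ : ℝ} (μ : ℝ) (ht : 0 < t) (hτ : 0 ≤ τ)
    (ha : a < 1) (hθ : Real.pi / 2 < θ) (hθ' : θ ≤ Real.pi) :
    IntegrableOn (fun x : ℝ => hankelExp t τ a μ (x + θ * I)) (Ioi 0) := by
  have hpi := Real.pi_pos
  obtain ⟨C, hC⟩ := exists_norm_hankelExp_le (θ := θ) μ ht hτ ha (by linarith)
    (Real.cos_neg_of_pi_div_two_lt_of_lt hθ (by linarith))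
  exact integrableOn_horizontal (continuous_hankelExp _ _ _ _) fun x hx => hC x hx _ ⟨le_rfl, hθ'⟩

open Complex Filter Topology in
/-- Integration by parts along the contour. -/
theorem im_logContour_hankelExp_succ {t θ : ℝ} (a s : ℝ) (ht : 0 < t) (ha : a < 1)
    (hθ : Real.pi / 2 < θ) (hθ' : θ ≤ Real.pi) :
    t * (logContour θ (hankelExp t 0 a (1 - s))).im =
      s * (logContour θ (hankelExp t 0 a (-s))).im := by
  have hpi := Real.pi_pos
  set g := hankelExp t 0 a (-s) with hg
  set f := hankelExp t 0 a (1 - s) with hf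
  have hgc : Continuous g := continuous_hankelExp _ _ _ _
  have hfc : Continuous f := continuous_hankelExp _ _ _ _
  have hderiv : ∀ w, HasDerivAt g (t * f w - s * g w) w := by
    intro w
    have hfg : f w = exp w * g w := by
      rw [hf, hg, hankelExp, hankelExp, ← Complex.exp_add]
      congr 1
      push_cast
      ring
    have h1 : HasDerivAt g _ w :=
      ((((hasDerivAt_exp w).const_mul (t : ℂ)).sub
        ((((hasDerivAt_id w).const_mul (a : ℂ)).cexp).const_mul ((0 : ℝ) : ℂ))).add
        ((hasDerivAt_id w).const_mul ((-s : ℝ) : ℂ))).cexp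
    refine h1.congr_deriv ?_
    rw [hfg, hg, hankelExp]
    simp
    ring
  have hfi := integrableOn_horizontal_hankelExp (τ := 0) (1 - s) ht le_rfl ha hθ hθ'
  have hgi := integrableOn_horizontal_hankelExp (τ := 0) (-s) ht le_rfl ha hθ hθ'
  have hlim : Tendsto (fun x : ℝ => g (x + θ * I)) atTop (𝓝 0) := by
    obtain ⟨C, hC⟩ := exists_norm_hankelExp_le (θ := θ) (-s) ht (le_refl 0) ha (by linarith)
      (Real.cos_neg_of_pi_div_two_lt_of_lt hθ (by linarith))
    refine squeeze_zero_norm' (a := fun x => C * Real.exp (-x)) ?_ ?_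
    · filter_upwards [eventually_ge_atTop 0] with x hx using hC x hx _ ⟨le_rfl, hθ'⟩
    · simpa using Real.tendsto_exp_neg_atTop_nhds_zero.const_mul C
  have hh := integral_Ioi_of_hasDerivAt_of_tendsto'
    (f := fun x : ℝ => g (x + θ * I)) (f' := fun x : ℝ => t * f (x + θ * I) - s * g (x + θ * I))
    (a := 0) (m := 0)
    (fun x _ => by
      have h1 : HasDerivAt (fun x : ℝ => (x : ℂ) + θ * I) 1 x :=
        (Complex.ofRealCLM.hasDerivAt (x := x)).add_const _
      exact ((hderiv (x + θ * I)).comp x h1).congr_deriv (mul_one _))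
    ((hfi.const_mul _).sub (hgi.const_mul _)) hlim
  rw [integral_sub (hfi.const_mul _) (hgi.const_mul _), integral_const_mul,
    integral_const_mul] at hh
  have hv := intervalIntegral.integral_eq_sub_of_hasDerivAt (a := 0) (b := θ)
    (f := fun y : ℝ => g (y * I)) (f' := fun y : ℝ => (t * f (y * I) - s * g (y * I)) * I)
    (fun y _ => by
      have h1 : HasDerivAt (fun y : ℝ => (y : ℂ) * I) (1 * I) y :=
        (Complex.ofRealCLM.hasDerivAt (x := y)).mul_const I
      exact ((hderiv (y * I)).comp y h1).congr_deriv (by rw [one_mul]))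
    (Continuous.intervalIntegrable (by fun_prop) _ _)
  rw [intervalIntegral.integral_mul_const, intervalIntegral.integral_sub
    (Continuous.intervalIntegrable (by fun_prop) _ _)
    (Continuous.intervalIntegrable (by fun_prop) _ _), intervalIntegral.integral_const_mul,
    intervalIntegral.integral_const_mul] at hv
  have hsum : t * logContour θ f - s * logContour θ g = -g 0 := by
    simp only [ofReal_zero, zero_add, zero_mul] at hh hv
    rw [logContour, logContour]
    linear_combination hh + hv
  -- The boundary term sits at w = 0, i.e. p = 1, and is real, so it disappears from the imaginary
  -- part.
  have hg0 : (g 0).im = 0 := by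
    have := hankelExp_add_mul_I t 0 a (-s) 0 0
    rw [hg]
    simp only [ofReal_zero, zero_mul, add_zero, mul_zero, Real.sin_zero, sub_self] at this
    rw [this, exp_ofReal_im]
  have := congrArg Complex.im hsum
  simp only [sub_im, mul_im, ofReal_re, ofReal_im, zero_mul, add_zero, neg_im, hg0] at this
  linarith

/-- Hankel's formula for the reciprocal Gamma function. -/
theorem im_logContour_hankelExp_eq {t θ s : ℝ} (a : ℝ) (ht : 0 < t) (hs : 0 < s)
    (hθ : Real.pi / 2 < θ) (hθ' : θ ≤ Real.pi) :
    (logContour θ (hankelExp t 0 a (1 - s))).im = Real.pi * (t ^ (s - 1) / Real.Gamma s) := by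
  -- The kernel at τ = 0 covers only s ≤ 1; integration by parts and Γ(s) = (s - 1) Γ(s - 1) raise s
  -- by one. The exponent 1/2 below is an arbitrary value in (0, 1), immaterial at τ = 0.
  obtain ⟨n, hn⟩ := exists_nat_ge (s - 1)
  induction n generalizing s with
  | zero =>
    have hs1 : s ≤ 1 := by simpa using hn
    have h := efrosKernel_eq_logContour (a := 1 / 2) ht le_rfl (by norm_num) (by norm_num) hs1
      hθ hθ'
    rw [efrosKernel_tau_zero ht hs hs1, hankelExp_tau_zero t _ a] at h
    rw [h, mul_inv_cancel_left₀ Real.pi_ne_zero]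
  | succ n ih =>
    rcases le_or_gt s 1 with hs1 | hs1
    · exact ih hs (by linarith [(Nat.cast_nonneg n : (0 : ℝ) ≤ n)])
    · have h0 : 0 < s - 1 := by linarith
      have h1 := ih h0 (by push_cast at hn; linarith)
      have h2 := im_logContour_hankelExp_succ (1 / 2) (s - 1) ht (by norm_num) hθ hθ'
      have hG := Real.Gamma_add_one h0.ne'
      have hG0 := Real.Gamma_pos_of_pos h0
      have ht1 : t ^ (s - 1) = t ^ (s - 1 - 1) * t := by
        rw [← Real.rpow_add_one ht.ne', sub_add_cancel]
      rw [sub_add_cancel] at hG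
      rw [hankelExp_tau_zero t _ a, hankelExp_tau_zero t (1 / 2) a (-(s - 1)), h1, neg_sub] at h2
      rw [hG, ht1, ← mul_right_inj' h0.ne', ← h2]
      field_simp

/-! ### Interchange of integrals and conclusion -/

open Complex in
theorem hankelExp_eq_mul (t τ a μ : ℝ) (w : ℂ) :
    hankelExp t τ a μ w = hankelExp t 0 a μ w * exp (-(τ * exp (a * w))) := by
  rw [hankelExp, hankelExp, ← Complex.exp_add]
  congr 1
  push_cast
  ring

open Complex in
theorem hankelExp_mul_inv_pow (t a μ : ℝ) (k : ℕ) (w : ℂ) :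
    hankelExp t 0 a μ w * (exp (a * w) ^ (k + 1))⁻¹ = hankelExp t 0 a (μ - a * (k + 1)) w := by
  rw [hankelExp, hankelExp, ← exp_nat_mul, ← exp_neg, ← Complex.exp_add]
  congr 1
  push_cast
  ring

open Complex in
-- The contour stays in |p| ≥ 1, which is why Re p^a is bounded away from 0 on it.
theorem cos_le_re_exp_mul {a θ x y : ℝ} (ha : 0 ≤ a) (haθ : a * θ < Real.pi / 2) (hx : 0 ≤ x)
    (hy : 0 ≤ y) (hyθ : y ≤ θ) : Real.cos (a * θ) ≤ (exp (a * (x + y * I))).re := by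
  have hpi := Real.pi_pos
  have h0 : 0 ≤ a * y := by positivity
  have h1 : a * y ≤ a * θ := by gcongr
  have h2 : Real.cos (a * θ) ≤ Real.cos (a * y) :=
    Real.cos_le_cos_of_nonneg_of_le_pi h0 (by linarith) h1
  have h3 : 0 < Real.cos (a * θ) := Real.cos_pos_of_mem_Ioo ⟨by linarith, haθ⟩
  have h4 : 1 ≤ Real.exp (a * x) := Real.one_le_exp (by positivity)
  have h : (a : ℂ) * (x + y * I) = (a * x : ℝ) + (a * y : ℝ) * I := by push_cast; ring
  rw [h, exp_re]
  simp only [add_re, add_im, mul_re, mul_im, ofReal_re, ofReal_im, I_re, I_im, mul_zero, mul_one,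
    sub_zero, add_zero, zero_add]
  nlinarith

open Complex in
theorem hasSum_integral_logContour_besselSeries {t a θ : ℝ} (μ lam : ℝ) (ht : 0 < t) (ha : 0 < a)
    (ha1 : a < 1) (hθ : Real.pi / 2 < θ) (hθ' : θ ≤ Real.pi) (haθ : a * θ < Real.pi / 2) :
    IntegrableOn (fun τ : ℝ => logContour θ (hankelExp t τ a μ) * besselSeries (lam * τ)) (Ioi 0) ∧
    HasSum (fun k : ℕ => (lam ^ k / k.factorial : ℂ) *
        logContour θ (hankelExp t 0 a (μ - a * (k + 1))))
      (∫ τ in Ioi (0 : ℝ), logContour θ (hankelExp t τ a μ) * besselSeries (lam * τ)) := by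
  have hpi := Real.pi_pos
  have hθ0 : 0 < θ := by linarith
  have hε : 0 < Real.cos (a * θ) := Real.cos_pos_of_mem_Ioo ⟨by nlinarith, haθ⟩
  have hc := continuous_hankelExp t 0 a μ
  have hH := hasSum_integral_mixture_besselSeries (ν := volume.restrict (Ioi (0 : ℝ)))
    (G := fun x : ℝ => hankelExp t 0 a μ (x + θ * I)) (P := fun x : ℝ => exp (a * (x + θ * I)))
    (integrableOn_horizontal_hankelExp μ ht le_rfl ha1 hθ hθ') (by fun_prop) hε
    (by
      filter_upwards [ae_restrict_mem measurableSet_Ioi] with x hx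
      exact cos_le_re_exp_mul ha.le haθ (le_of_lt hx) hθ0.le le_rfl) lam
  have hV := hasSum_integral_mixture_besselSeries (ν := volume.restrict (Ioc (0 : ℝ) θ))
    (G := fun y : ℝ => hankelExp t 0 a μ (y * I)) (P := fun y : ℝ => exp (a * (y * I)))
    ((Continuous.integrableOn_Icc (by fun_prop)).mono_set Ioc_subset_Icc_self) (by fun_prop) hε
    (by
      filter_upwards [ae_restrict_mem measurableSet_Ioc] with y hy
      simpa using cos_le_re_exp_mul ha.le haθ le_rfl hy.1.le hy.2) lam
  simp only [← hankelExp_eq_mul, hankelExp_mul_inv_pow] at hH hV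
  have hsplit : ∀ τ : ℝ, logContour θ (hankelExp t τ a μ) * besselSeries (lam * τ) =
      (∫ x in Ioi (0 : ℝ), hankelExp t τ a μ (x + θ * I)) * besselSeries (lam * τ) +
      I * ((∫ y in Ioc 0 θ, hankelExp t τ a μ (y * I)) * besselSeries (lam * τ)) := by
    intro τ
    rw [logContour, intervalIntegral.integral_of_le hθ0.le]
    ring
  simp only [hsplit]
  refine ⟨hH.1.add (hV.1.const_mul I), ?_⟩
  rw [integral_add hH.1 (hV.1.const_mul I), integral_const_mul]
  refine (congrArg (HasSum · _) (funext fun k => ?_)).mpr (hH.2.add (hV.2.mul_left I))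
  rw [logContour, intervalIntegral.integral_of_le hθ0.le]
  ring

open Complex in
theorem wright_formula_of_pos {α β t : ℝ} (lam : ℝ) (hα : 0 < α) (hα1 : α < 1) (hβ : 0 < β)
    (hβ1 : β ≤ 1 + α) (ht : 0 < t) :
    IntegrableOn
        (fun t₁ : ℝ => (efrosKernel α (β - α) t t₁ : ℂ) * besselFactor lam t₁) (Ioi 0) ∧
      ((t ^ (β - 1) : ℝ) : ℂ) * wright α β ((lam * t ^ α : ℝ) : ℂ) =
        ∫ t₁ in Ioi (0 : ℝ), (efrosKernel α (β - α) t t₁ : ℂ) * besselFactor lam t₁ := by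
  have hpi := Real.pi_pos
  -- θ > π/2 makes e^{tp} decay on the ray; αθ < π/2 keeps Re p^α positive. Both are possible
  -- because α < 1.
  obtain ⟨θ, hθ, hθ2⟩ : ∃ θ, Real.pi / 2 < θ ∧ θ < min Real.pi (Real.pi / 2 / α) := by
    refine exists_between (lt_min (by linarith) ?_)
    rw [lt_div_iff₀ hα]
    nlinarith
  obtain ⟨hθ', haθ⟩ := lt_min_iff.1 hθ2
  rw [lt_div_iff₀ hα, mul_comm] at haθ
  obtain ⟨hint, hsum⟩ := hasSum_integral_logContour_besselSeries (1 - (β - α)) lam ht hα hα1 hθ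
    hθ'.le haθ
  have him : ∀ (z : ℂ) (r : ℝ), (z * r).im = z.im * r := fun z r => by simp
  have hK : EqOn (fun t₁ : ℝ => (efrosKernel α (β - α) t t₁ : ℂ) * besselFactor lam t₁)
      (fun τ : ℝ => ((Real.pi⁻¹ * (logContour θ (hankelExp t τ α (1 - (β - α))) *
        besselSeries (lam * τ)).im : ℝ) : ℂ)) (Ioi 0) := by
    intro τ hτ
    have h := efrosKernel_eq_logContour (a := α) (b := β - α) ht (le_of_lt hτ) hα hα1
      (by linarith) hθ hθ'.le
    simp only [h, besselFactor_eq, him]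
    push_cast
    ring
  have hint' := hint.im.const_mul Real.pi⁻¹
  constructor
  · exact (integrableOn_congr_fun hK measurableSet_Ioi).2 hint'.ofReal
  · rw [setIntegral_congr_fun measurableSet_Ioi hK, integral_complex_ofReal, integral_const_mul]
    have h1 : ∫ τ in Ioi (0 : ℝ), (logContour θ (hankelExp t τ α (1 - (β - α))) *
        besselSeries (lam * τ)).im = (∫ τ in Ioi (0 : ℝ),
          logContour θ (hankelExp t τ α (1 - (β - α))) * besselSeries (lam * τ)).im :=
      imCLM.integral_comp_comm hint
    rw [h1, ← (hasSum_im hsum).tsum_eq, wright, ← tsum_mul_left, ← tsum_mul_left, ofReal_tsum]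
    congr 1
    ext k
    have hs : 0 < α * k + β := by positivity
    have h2 := im_logContour_hankelExp_eq α ht hs hθ hθ'.le
    -- The Laplace factor p^{-α(k+1)} turns p^{α-β} into p^{-(αk+β)}.
    have h3 : 1 - (β - α) - α * ((k : ℝ) + 1) = 1 - (α * k + β) := by ring
    have h4 : ((lam : ℂ) ^ k / k.factorial) = ((lam ^ k / k.factorial : ℝ) : ℂ) := by push_cast; rfl
    have h5 : t ^ (α * k + β - 1) = t ^ (β - 1) * (t ^ α) ^ k := by
      rw [← Real.rpow_natCast, ← Real.rpow_mul ht.le, ← Real.rpow_add ht]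
      ring_nf
    rw [h3, h4, im_ofReal_mul, h2, h5, ← ofReal_pow, ← ofReal_natCast, ← ofReal_mul, ← ofReal_div,
      ← ofReal_mul]
    congr 1
    have := Real.Gamma_pos_of_pos hs
    field_simp
    rw [mul_pow]

open Complex in
theorem integrableOn_efrosIntegrand_of_cases {a b t τ : ℝ} (ha : 0 < a) (ha1 : a < 1) (hb : b ≤ 1)
    (ht : 0 < t ∨ t = 0 ∧ a < 1 / 2) (hτ : 0 < τ) :
    IntegrableOn (fun u : ℝ => efrosIntegrand a b t τ u) (Ioi 0) := by
  have hpi := Real.pi_pos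
  rcases ht with ht | ⟨rfl, ha2⟩
  · obtain ⟨C, hC⟩ := exists_norm_hankelExp_le (1 - b) ht hτ.le ha1 hpi.le (by simp)
    exact integrableOn_efrosIntegrand ht.le hτ.le ha hb fun x hx => hC x hx _ ⟨le_rfl, le_rfl⟩
  · obtain ⟨C, hC⟩ := exists_norm_hankelExp_zero_le (1 - b) hτ ha ha2
    exact integrableOn_efrosIntegrand le_rfl hτ.le ha hb fun x hx => hC x hx _ ⟨hpi.le, le_rfl⟩

theorem mainTheorem10 (lam : ℝ) :
    (∀ α β t : ℝ, 0 < α → α < 1 → 0 < β → β ≤ 1 + α →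
      (0 < t ∨ (t = 0 ∧ α < 1 / 2 ∧ 1 < β)) →
      (∀ t₁ : ℝ, 0 < t₁ →
        IntegrableOn (fun u : ℝ => efrosIntegrand α (β - α) t t₁ u) (Ioi 0)) ∧
      IntegrableOn
        (fun t₁ : ℝ => (efrosKernel α (β - α) t t₁ : ℂ) * besselFactor lam t₁) (Ioi 0) ∧
      ((t ^ (β - 1) : ℝ) : ℂ) * wright α β ((lam * t ^ α : ℝ) : ℂ) =
        ∫ t₁ in Ioi (0 : ℝ), (efrosKernel α (β - α) t t₁ : ℂ) * besselFactor lam t₁) ∧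
    (∀ t : ℝ, 0 ≤ t →
      IntegrableOn (fun t₁ : ℝ => (heavisideStep (t - t₁) : ℂ) * besselFactor lam t₁) (Ioi 0) ∧
      ((t ^ ((2 : ℝ) - 1) : ℝ) : ℂ) * wright 1 2 ((lam * t ^ (1 : ℝ) : ℝ) : ℂ) =
        ∫ t₁ in Ioi (0 : ℝ), (heavisideStep (t - t₁) : ℂ) * besselFactor lam t₁) ∧
    (∀ t : ℝ, 0 ≤ t →
      ((t ^ ((1 : ℝ) - 1) : ℝ) : ℂ) * wright 1 1 ((lam * t ^ (1 : ℝ) : ℝ) : ℂ) =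
        ∫ t₁ in Ici (0 : ℝ), besselFactor lam t₁ ∂(Measure.dirac t)) := by
  refine ⟨fun α β t hα hα1 hβ hβ1 ht => ⟨fun t₁ ht₁ => ?_, ?_⟩, fun t ht => heaviside_formula lam ht,
    fun t ht => dirac_formula lam ht⟩
  · exact integrableOn_efrosIntegrand_of_cases hα hα1 (by linarith)
      (ht.imp_right fun h => ⟨h.1, h.2.1⟩) ht₁
  · rcases ht with ht | ⟨rfl, hα2, hβ2⟩
    · exact wright_formula_of_pos lam hα hα1 hβ hβ1 ht
    -- At t = 0 both sides vanish: the kernel is zero, and 0^{β-1} = 0 because β > 1.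
    · have hK : EqOn (fun t₁ : ℝ => (efrosKernel α (β - α) 0 t₁ : ℂ) * besselFactor lam t₁)
          (fun _ => 0) (Ioi 0) := fun τ hτ => by
        simp [efrosKernel_zero hτ hα hα2 (by linarith : β - α ≤ 1)]
      refine ⟨(integrableOn_congr_fun hK measurableSet_Ioi).2 integrableOn_zero, ?_⟩
      rw [setIntegral_congr_fun measurableSet_Ioi hK, Real.zero_rpow (by linarith)]
      simp
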